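/- **Theorem.** Consider the random plates-and-olives process. It starts with an empty table. At each step, one of the available moves is chosen uniformly at random and performed. The moves are: ($P^+$) add an empty plate (always available); ($P^-$) choose an unordered pair of distinct plates, put all their olives on one of them, and remove the other from the table; when the first plate is one of the two, it is the one that is kept; ($O^+$) choose a plate and add one olive to it; ($O^-$) choose a plate that carries at least one olive and remove one olive from it. The plates are distinguishable, the olives are not (so with $\ell$ plates, $k$ of them non-empty, there are $1+\binom{\ell}{2}+\ell+k$ available moves). Let $O_t$ be the total number of olives on the table after $t$ moves. (a) There are absolute constants $C>0$ and $\frac1{342}\le c_1\le c_2\le\frac23$ such that for all sufficiently large $t$ $$\Pr(c_1t\le O_t\le c_2t)\ge 1-e^{-Ct}.$$ (b) There are absolute constants $A>0$ and $K$ such that for all $t$ and all $\delta\ge0$ with $\delta^2t\ge K$ $$\Pr(|O_t-\mathbf{E}(O_t)|\ge\delta t)\le e^{-A\delta^2t}.$$ In particular, with this absolute $A$, the bound holds for each fixed $\delta\ge 0$ and all $t$ large enough in terms of $\delta$ (for $\delta=0$ it is trivial). (c) There is an absolute constant $B>0$ such that the probability that at all times $0,1,\dots,t$ every plate other than the first one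 has at most $B\log t$ olives tends to $1$ as $t\to\infty$. -/

import Mathlib

open Filter Topology MeasureTheory

namespace PlatesOlives

/-- A table: the list of the numbers of olives on the plates (in the order in which the plates
were added). The plates are distinguished by their position; the olives are only counted. The
first plate is the head of the list. -/
abbrev Table := List ℕ

/-- The moves: add an empty plate, combine plates `i` and `j`, add an olive to plate `i`, remove
an olive from plate `i` (positions are counted from `0`). -/
inductive Move where
  | addPlate : Move
  | combine (i j : ℕ) : Move
  | addOlive (i : ℕ) : Move
  | removeOlive (i : ℕ) : Move
  deriving DecidableEq

/-- Which moves are available on the table `T`. An unordered pair of plates is written with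
`i < j`. -/
def Available (T : Table) : Move → Prop
  | .addPlate => True
  | .combine i j => i < j ∧ j < T.length
  | .addOlive i => i < T.length
  | .removeOlive i => i < T.length ∧ 0 < T.getD i 0

/-- The finite set of all available moves on the table `T` (see `mem_moves`). -/
def moves (T : Table) : Finset Move :=
  {Move.addPlate}
    ∪ (((Finset.range T.length ×ˢ Finset.range T.length).filter fun p => p.1 < p.2).image
        fun p => Move.combine p.1 p.2)
    ∪ (Finset.range T.length).image Move.addOlive
    ∪ ((Finset.range T.length).filter fun i => 0 < T.getD i 0).image Move.removeOlive

theorem mem_moves (T : Table) (m : Move) : m ∈ moves T ↔ Available T m := by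
  cases m with
  | addPlate => simp [moves, Available]
  | combine i j => simp [moves, Available]; omega
  | addOlive i => simp [moves, Available]
  | removeOlive i => simp [moves, Available]

theorem moves_nonempty (T : Table) : (moves T).Nonempty :=
  ⟨Move.addPlate, (mem_moves T _).2 trivial⟩

/-- The table after a move. When plates `i < j` are combined, all their olives are put on plate
`i` and plate `j` is removed; so the first plate is never removed. -/
def play (T : Table) : Move → Table
  | .addPlate => T ++ [0]
  | .combine i j => (T.set i (T.getD i 0 + T.getD j 0)).eraseIdx j
  | .addOlive i => T.set i (T.getD i 0 + 1)
  | .removeOlive i => T.set i (T.getD i 0 - 1)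

/-- One random step: an available move, chosen uniformly at random, is performed. -/
noncomputable def step (T : Table) : PMF Table :=
  (PMF.uniformOfFinset (moves T) (moves_nonempty T)).map (play T)

/-- A history of the process: the current table and the list of all earlier tables. -/
structure History where
  /-- The current table. -/
  current : Table
  /-- The earlier tables, the latest first. -/
  past : List Table

instance : MeasurableSpace History := ⊤

/-- All tables that occurred, including the current one. -/
def History.tables (h : History) : List Table := h.current :: h.past

/-- The total number of olives on the current table. -/
def History.olives (h : History) : ℕ := h.current.sum

/-- The law of the history of the process after `t` moves, starting from the empty table. -/
noncomputable def law : ℕ → PMF History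
  | 0 => PMF.pure ⟨[], []⟩
  | t + 1 => (law t).bind fun h => (step h.current).map fun T => ⟨T, h.tables⟩

/-- The probability of an event that concerns the process up to time `t`. -/
noncomputable def prob (t : ℕ) (E : Set History) : ℝ := (law t).toMeasure.real E

/-- The expected number of olives at time `t`. -/
noncomputable def meanOlives (t : ℕ) : ℝ := ∫ h, (h.olives : ℝ) ∂(law t).toMeasure

end PlatesOlives

/-!
Everything rests on the multiset of the loads of the plates. The expected number of olives after
`n` further moves, `meanAfter n`, is a function of this multiset, and `meanAfter (t - s)` of the
current table is a martingale in `s` that ends with the number of olives at time `t`. The key to the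
concentration is that this martingale has bounded increments. No coupling of two processes is
needed: three inductions on `n` compare the moves from two similar tables one by one. One more olive
changes `meanAfter n` by at most `1` (`abs_meanAfter_add_olive_le`), one more empty plate by at most
`2` (`abs_meanAfter_add_plate_le`), and moving olives from one plate to another by at most `3/2`
(`abs_meanAfter_transfer_le`); combining two plates is such a transfer, followed by the removal of
an empty plate. In all three cases most moves preserve the relation between the two tables. A move that
has no counterpart leads back to the other table or close to it, and then the comparison is shifted
by one unit of time; this costs at most `1/2`, because the expected number of olives increases by
between `0` and `1/2` in each step (`meanAfter_succ_sub_mem`). Azuma's inequality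
(`prob_add_le_le_exp`) gives the concentration.

The drift of at most `1/2` and Azuma's inequality also give the upper bound on the growth. For the
lower bound the number of olives is corrected by a reward for the presence of an empty plate and a
penalty for the number of plates; the resulting `potential` has drift at least `1/30` on every table
(`total_potential_ge`) and exceeds the number of olives by at most `1/5`.

For the plates other than the first, an exponential weight of their loads increases by at most `1`
in expectation in each step (`avg_weight_tail_le`): merging with the first plate removes a large
load at a rate that outweighs the random fluctuation of the loads, and merging in general keeps the
number of plates small. Markov's inequality for the sum of the weights over the whole history
(`prob_exists_large_le`) bounds all loads up to time `t` at once.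
-/

/-! ### Finitely supported laws and the one-step average -/

namespace PMF

variable {α β : Type*}

/-- The expectation of a real function under a probability mass function, as a plain sum; it is
used for finitely supported laws only, so summability is no issue. -/
noncomputable def expect (p : PMF α) (g : α → ℝ) : ℝ := ∑' a, (p a).toReal * g a

theorem expect_eq_sum (p : PMF α) (g : α → ℝ) {s : Finset α} (hs : p.support ⊆ s) :
    p.expect g = ∑ a ∈ s, (p a).toReal * g a := by
  refine tsum_eq_sum fun a ha => ?_
  have : p a = 0 := by
    by_contra h
    exact ha (hs ((p.mem_support_iff a).2 h))
  simp [this]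

theorem expect_pure (a : α) (g : α → ℝ) : (PMF.pure a).expect g = g a := by
  classical
  rw [expect_eq_sum (PMF.pure a) g (s := {a}) (by simp)]
  simp

theorem expect_bind (p : PMF α) (f : α → PMF β) (g : β → ℝ) (hp : p.support.Finite)
    (hf : ∀ a, (f a).support.Finite) :
    (p.bind f).expect g = p.expect fun a => (f a).expect g := by
  have hU : (p.bind f).support.Finite := by
    rw [support_bind]
    exact hp.biUnion fun a _ => hf a
  rw [expect_eq_sum (p.bind f) g (s := hU.toFinset) (by simp),
    expect_eq_sum p _ (s := hp.toFinset) (by simp)]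
  have h1 : ∀ b, ((p.bind f) b).toReal = ∑ a ∈ hp.toFinset, (p a).toReal * (f a b).toReal := by
    intro b
    rw [bind_apply, tsum_eq_sum (s := hp.toFinset), ENNReal.toReal_sum]
    · simp [ENNReal.toReal_mul]
    · intro a _
      exact ENNReal.mul_ne_top (p.apply_ne_top a) ((f a).apply_ne_top b)
    · intro a ha
      have : p a = 0 := by
        by_contra h
        exact ha (by simpa using h)
      simp [this]
  simp_rw [h1, Finset.sum_mul]
  rw [Finset.sum_comm]
  refine Finset.sum_congr rfl fun a ha => ?_
  rw [expect_eq_sum (f a) g (s := hU.toFinset), Finset.mul_sum]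
  · exact Finset.sum_congr rfl fun b _ => by ring
  · intro b hb
    simp only [Set.Finite.coe_toFinset]
    rw [mem_support_bind_iff]
    exact ⟨a, by simpa using ha, hb⟩

theorem expect_map_uniformOfFinset (s : Finset α) (hs : s.Nonempty) (φ : α → β) (g : β → ℝ) :
    ((uniformOfFinset s hs).map φ).expect g = (∑ a ∈ s, g (φ a)) / s.card := by
  have hfin : (uniformOfFinset s hs).support.Finite := by simp
  rw [PMF.map, expect_bind _ _ _ hfin (fun a => by simp [support_pure])]
  simp only [Function.comp_apply, expect_pure]
  rw [expect_eq_sum _ _ (s := s) (by simp), Finset.sum_div]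
  refine Finset.sum_congr rfl fun a ha => ?_
  rw [uniformOfFinset_apply_of_mem hs ha]
  simp
  ring

theorem integrable_of_support_finite [MeasurableSpace α] [MeasurableSingletonClass α]
    (p : PMF α) (hp : p.support.Finite) (g : α → ℝ) : Integrable g p.toMeasure := by
  rw [← restrict_toMeasure_support p]
  exact IntegrableOn.of_finite hp

theorem integral_eq_expect [MeasurableSpace α] [MeasurableSingletonClass α]
    (p : PMF α) (hp : p.support.Finite) (g : α → ℝ) : ∫ a, g a ∂p.toMeasure = p.expect g := by
  rw [integral_eq_tsum p g (integrable_of_support_finite p hp g)]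
  rfl

end PMF

namespace PlatesOlives

instance : DiscreteMeasurableSpace History := ⟨fun _ => trivial⟩

theorem card_moves_pos (T : Table) : 0 < ((moves T).card : ℝ) :=
  Nat.cast_pos.2 (Finset.card_pos.2 (moves_nonempty T))

/-- The expectation of `f` after one random step from the table `T`. -/
noncomputable def avg (f : Table → ℝ) (T : Table) : ℝ :=
  (∑ m ∈ moves T, f (play T m)) / (moves T).card

theorem avg_mono {f g : Table → ℝ} {T : Table} (h : ∀ m ∈ moves T, f (play T m) ≤ g (play T m)) :
    avg f T ≤ avg g T :=
  div_le_div_of_nonneg_right (Finset.sum_le_sum h) (card_moves_pos T).le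

theorem avg_add (f g : Table → ℝ) (T : Table) :
    avg (fun T' => f T' + g T') T = avg f T + avg g T := by
  simp [avg, Finset.sum_add_distrib, add_div]

theorem avg_const_mul (c : ℝ) (f : Table → ℝ) (T : Table) :
    avg (fun T' => c * f T') T = c * avg f T := by
  simp [avg, ← Finset.mul_sum, mul_div_assoc]

theorem avg_const (c : ℝ) (T : Table) : avg (fun _ => c) T = c := by
  have := (card_moves_pos T).ne'
  simp only [avg, Finset.sum_const, nsmul_eq_mul]
  field_simp

theorem support_step_finite (T : Table) : (step T).support.Finite := by
  rw [step, PMF.support_map]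
  exact Set.Finite.image _ (by simp)

theorem support_law_finite (t : ℕ) : (law t).support.Finite := by
  induction t with
  | zero => simp [law]
  | succ t ih =>
    rw [law, PMF.support_bind]
    refine ih.biUnion fun h _ => ?_
    rw [PMF.support_map]
    exact (support_step_finite _).image _

theorem integrable_law (t : ℕ) (g : History → ℝ) : Integrable g (law t).toMeasure :=
  PMF.integrable_of_support_finite _ (support_law_finite t) g

theorem integral_law_zero (g : History → ℝ) : ∫ h, g h ∂(law 0).toMeasure = g ⟨[], []⟩ := by
  rw [PMF.integral_eq_expect _ (support_law_finite 0)]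
  exact PMF.expect_pure _ _

theorem integral_law_succ (t : ℕ) (g : History → ℝ) :
    ∫ h, g h ∂(law (t + 1)).toMeasure =
      ∫ h, avg (fun T => g ⟨T, h.tables⟩) h.current ∂(law t).toMeasure := by
  rw [PMF.integral_eq_expect _ (support_law_finite _), PMF.integral_eq_expect _
    (support_law_finite _), law, PMF.expect_bind _ _ _ (support_law_finite t)]
  · congr 1
    ext h
    rw [step, PMF.map_comp, PMF.expect_map_uniformOfFinset]
    rfl
  · intro h
    rw [PMF.support_map]
    exact (support_step_finite _).image _

theorem integral_le_of_avg_le (t : ℕ) (W : ℕ → Table → ℝ)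
    (hW : ∀ s < t, ∀ T, avg (W (s + 1)) T ≤ W s T) :
    ∫ h, W t h.current ∂(law t).toMeasure ≤ W 0 [] := by
  suffices ∀ s ≤ t, ∫ h, W s h.current ∂(law s).toMeasure ≤ W 0 [] from this t le_rfl
  intro s
  induction s with
  | zero => intro _; rw [integral_law_zero]
  | succ s ih =>
    intro hs
    rw [integral_law_succ]
    exact (integral_mono (integrable_law _ _) (integrable_law _ _)
      fun h => hW s hs h.current).trans (ih (by omega))

theorem prob_mono (t : ℕ) {E F : Set History} (h : E ⊆ F) : prob t E ≤ prob t F :=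
  measureReal_mono h

theorem prob_union_le (t : ℕ) (E F : Set History) : prob t (E ∪ F) ≤ prob t E + prob t F :=
  measureReal_union_le E F

theorem prob_le_one (t : ℕ) (E : Set History) : prob t E ≤ 1 := measureReal_le_one

theorem prob_compl (t : ℕ) (E : Set History) : prob t Eᶜ = 1 - prob t E :=
  probReal_compl_eq_one_sub (MeasurableSet.of_discrete)

/-- Markov's inequality. -/
theorem prob_le_integral_div (t : ℕ) {g : History → ℝ} (hg : ∀ h, 0 ≤ g h) {v : ℝ} (hv : 0 < v) :
    prob t {h | v ≤ g h} ≤ (∫ h, g h ∂(law t).toMeasure) / v := by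
  rw [le_div_iff₀ hv, mul_comm]
  exact mul_meas_ge_le_integral_of_nonneg (Eventually.of_forall hg) (integrable_law t g) v

/-! ### Azuma's inequality for the process -/

/-- On an interval `[-c, c]` the exponential lies below its chord, and the slope of the chord is
nonnegative. -/
theorem exp_mul_le_cosh_add {l c y : ℝ} (hc : 0 < c) (hy : |y| ≤ c) :
    Real.exp (l * y) ≤ Real.cosh (l * c) + y / c * Real.sinh (l * c) := by
  obtain ⟨h1, h2⟩ := abs_le.1 hy
  have ha : 0 ≤ (1 + y / c) / 2 := by
    have : -1 ≤ y / c := by rw [le_div_iff₀ hc]; linarith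
    linarith
  have hb : 0 ≤ (1 - y / c) / 2 := by
    have : y / c ≤ 1 := by rw [div_le_iff₀ hc]; linarith
    linarith
  have hconv := convexOn_exp.2 (Set.mem_univ (l * c)) (Set.mem_univ (-(l * c))) ha hb (by ring)
  simp only [smul_eq_mul] at hconv
  have e : (1 + y / c) / 2 * (l * c) + (1 - y / c) / 2 * (-(l * c)) = l * y := by
    field_simp
    ring
  rw [e] at hconv
  rw [Real.cosh_eq, Real.sinh_eq]
  linarith

/-- A step of a supermartingale with increments at most `c`: Hoeffding's bound on its exponential
moment. -/
theorem avg_exp_le {l c : ℝ} (hl : 0 ≤ l) (hc : 0 < c) (f : Table → ℝ) (T : Table) (x : ℝ)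
    (hmean : avg f T ≤ x) (hinc : ∀ m ∈ moves T, |f (play T m) - x| ≤ c) :
    avg (fun T' => Real.exp (l * f T')) T ≤ Real.exp (l * x + l ^ 2 * c ^ 2 / 2) := by
  have hs : 0 ≤ Real.sinh (l * c) := Real.sinh_nonneg_iff.2 (by positivity)
  have h1 : avg (fun T' => Real.exp (l * f T')) T ≤
      avg (fun T' => Real.exp (l * x) * (Real.cosh (l * c) - x / c * Real.sinh (l * c)) +
        Real.exp (l * x) / c * Real.sinh (l * c) * f T') T := by
    refine avg_mono fun m hm => ?_
    have := mul_le_mul_of_nonneg_left (exp_mul_le_cosh_add (l := l) hc (hinc m hm))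
      (Real.exp_pos (l * x)).le
    rw [← Real.exp_add] at this
    have e : l * x + l * (f (play T m) - x) = l * f (play T m) := by ring
    rw [e] at this
    refine this.trans (le_of_eq ?_)
    ring
  rw [avg_add, avg_const, avg_const_mul] at h1
  have h2 : Real.exp (l * x) / c * Real.sinh (l * c) * avg f T ≤
      Real.exp (l * x) / c * Real.sinh (l * c) * x :=
    mul_le_mul_of_nonneg_left hmean (by positivity)
  have h3 : Real.cosh (l * c) ≤ Real.exp (l ^ 2 * c ^ 2 / 2) := by
    have := Real.cosh_le_exp_half_sq (l * c)
    rwa [mul_pow] at this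
  rw [Real.exp_add]
  have h4 := mul_le_mul_of_nonneg_left h3 (Real.exp_pos (l * x)).le
  have h5 : Real.exp (l * x) * (Real.cosh (l * c) - x / c * Real.sinh (l * c)) +
      Real.exp (l * x) / c * Real.sinh (l * c) * x = Real.exp (l * x) * Real.cosh (l * c) := by
    ring
  linarith

/-- **Azuma's inequality**: `M s T` is a function of the time and of the table that is a
supermartingale along the process, with increments at most `c`. -/
theorem prob_add_le_le_exp {c u : ℝ} (hc : 0 < c) (hu : 0 ≤ u) (t : ℕ) (M : ℕ → Table → ℝ)
    (hmean : ∀ s < t, ∀ T, avg (M (s + 1)) T ≤ M s T)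
    (hinc : ∀ s < t, ∀ T, ∀ m ∈ moves T, |M (s + 1) (play T m) - M s T| ≤ c) :
    prob t {h | M 0 [] + u ≤ M t h.current} ≤ Real.exp (-(u ^ 2 / (2 * c ^ 2 * t))) := by
  rcases Nat.eq_zero_or_pos t with rfl | ht
  · simpa using prob_le_one 0 _
  have ht' : (0 : ℝ) < t := Nat.cast_pos.2 ht
  -- the exponent that optimizes the Chernoff bound
  set l : ℝ := u / (c ^ 2 * t) with hl
  have hl0 : 0 ≤ l := by positivity
  have hI := integral_le_of_avg_le t
    (fun s T => Real.exp (-(s * (l ^ 2 * c ^ 2 / 2))) * Real.exp (l * M s T))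
    (fun s hs T => by
      rw [avg_const_mul]
      refine (mul_le_mul_of_nonneg_left (avg_exp_le hl0 hc _ T _ (hmean s hs T) (hinc s hs T))
        (Real.exp_pos _).le).trans (le_of_eq ?_)
      rw [← Real.exp_add, ← Real.exp_add]
      congr 1
      push_cast
      ring)
  have hM := prob_le_integral_div t
    (g := fun h => Real.exp (-(t * (l ^ 2 * c ^ 2 / 2))) * Real.exp (l * M t h.current))
    (fun h => by positivity)
    (v := Real.exp (-(t * (l ^ 2 * c ^ 2 / 2))) * Real.exp (l * (M 0 [] + u))) (by positivity)
  refine (prob_mono t ?_).trans (hM.trans ((div_le_div_of_nonneg_right hI (by positivity)).trans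
    (le_of_eq ?_)))
  · intro h hh
    simp only [Set.mem_ofPred_eq] at hh ⊢
    gcongr
  · rw [← Real.exp_add, ← Real.exp_add, ← Real.exp_sub]
    congr 1
    rw [hl]
    field_simp
    simp
    ring

/-! ### The process on multisets of loads -/

/-- The sum of `f` over all tables that can be reached by one move from a table with loads `S`,
counted with the number of moves that lead there. Loads form a multiset: the order of the plates
is forgotten. -/
noncomputable def total (f : Multiset ℕ → ℝ) (S : Multiset ℕ) : ℝ :=
  f (0 ::ₘ S) + ((S.powersetCard 2).map fun P => f (P.sum ::ₘ (S - P))).sum +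
    (S.map fun a => f ((a + 1) ::ₘ S.erase a)).sum +
    (S.map fun a => if 0 < a then f ((a - 1) ::ₘ S.erase a) else 0).sum

/-- Splitting off one plate, with load `a`: the moves that do not touch it are the moves from the
remaining loads `R`. -/
theorem total_cons (f : Multiset ℕ → ℝ) (a : ℕ) (R : Multiset ℕ) :
    total f (a ::ₘ R) = total (fun U => f (a ::ₘ U)) R +
      (R.map fun r => f ((a + r) ::ₘ R.erase r)).sum + f ((a + 1) ::ₘ R) +
      if 0 < a then f ((a - 1) ::ₘ R) else 0 := by
  have h1 : (((a ::ₘ R).powersetCard 2).map fun P => f (P.sum ::ₘ (a ::ₘ R - P))).sum =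
      ((R.powersetCard 2).map fun P => f (a ::ₘ P.sum ::ₘ (R - P))).sum +
        (R.map fun r => f ((a + r) ::ₘ R.erase r)).sum := by
    rw [Multiset.powersetCard_cons, Multiset.map_add, Multiset.sum_add]
    congr 1
    · congr 1
      refine Multiset.map_congr rfl fun P hP => ?_
      have hle := (Multiset.mem_powersetCard.1 hP).1
      rw [Multiset.cons_sub_of_le _ hle, Multiset.cons_swap]
    · rw [Multiset.powersetCard_one, Multiset.map_map, Multiset.map_map]
      congr 1
      refine Multiset.map_congr rfl fun r _ => ?_
      simp [Multiset.sub_cons]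
  have h2 : ((a ::ₘ R).map fun b => f ((b + 1) ::ₘ (a ::ₘ R).erase b)).sum =
      f ((a + 1) ::ₘ R) + (R.map fun b => f (a ::ₘ (b + 1) ::ₘ R.erase b)).sum := by
    rw [Multiset.map_cons, Multiset.sum_cons, Multiset.erase_cons_head]
    congr 2
    refine Multiset.map_congr rfl fun r hr => ?_
    rw [Multiset.erase_cons_tail_of_mem hr, Multiset.cons_swap]
  have h3 : ((a ::ₘ R).map fun b => if 0 < b then f ((b - 1) ::ₘ (a ::ₘ R).erase b) else 0).sum =
      (if 0 < a then f ((a - 1) ::ₘ R) else 0) +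
        (R.map fun b => if 0 < b then f (a ::ₘ (b - 1) ::ₘ R.erase b) else 0).sum := by
    rw [Multiset.map_cons, Multiset.sum_cons, Multiset.erase_cons_head]
    congr 2
    refine Multiset.map_congr rfl fun r hr => ?_
    rw [Multiset.erase_cons_tail_of_mem hr, Multiset.cons_swap]
  rw [total, h1, h2, h3, total, Multiset.cons_swap]
  ring

/-- Splitting off two plates, with loads `a` and `b`. -/
theorem total_cons_cons (f : Multiset ℕ → ℝ) (a b : ℕ) (R : Multiset ℕ) :
    total f (a ::ₘ b ::ₘ R) = total (fun U => f (a ::ₘ b ::ₘ U)) R +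
      (R.map fun r => f (a ::ₘ (b + r) ::ₘ R.erase r)).sum +
      (R.map fun r => f ((a + r) ::ₘ b ::ₘ R.erase r)).sum +
      f (a ::ₘ (b + 1) ::ₘ R) + f ((a + 1) ::ₘ b ::ₘ R) + f ((a + b) ::ₘ R) +
      ((if 0 < a then f ((a - 1) ::ₘ b ::ₘ R) else 0) +
        if 0 < b then f (a ::ₘ (b - 1) ::ₘ R) else 0) := by
  rw [total_cons, total_cons]
  have h : ((b ::ₘ R).map fun r => f ((a + r) ::ₘ (b ::ₘ R).erase r)).sum =
      f ((a + b) ::ₘ R) + (R.map fun r => f ((a + r) ::ₘ b ::ₘ R.erase r)).sum := by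
    rw [Multiset.map_cons, Multiset.sum_cons, Multiset.erase_cons_head]
    congr 2
    refine Multiset.map_congr rfl fun r hr => ?_
    rw [Multiset.erase_cons_tail_of_mem hr]
  rw [h]
  ring

theorem total_zero (f : Multiset ℕ → ℝ) : total f 0 = f {0} := by
  simp [total]
  simp [Multiset.powersetCard_zero_right]

theorem total_add (f g : Multiset ℕ → ℝ) (S : Multiset ℕ) :
    total (fun U => f U + g U) S = total f S + total g S := by
  have h : ∀ a : ℕ, (if 0 < a then f ((a - 1) ::ₘ S.erase a) + g ((a - 1) ::ₘ S.erase a) else 0) =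
      (if 0 < a then f ((a - 1) ::ₘ S.erase a) else 0) +
        (if 0 < a then g ((a - 1) ::ₘ S.erase a) else 0) := by
    intro a
    split_ifs <;> simp
  simp only [total, h, Multiset.sum_map_add]
  ring

theorem total_const_mul (c : ℝ) (f : Multiset ℕ → ℝ) (S : Multiset ℕ) :
    total (fun U => c * f U) S = c * total f S := by
  have h : ∀ a : ℕ, (if 0 < a then c * f ((a - 1) ::ₘ S.erase a) else 0) =
      c * (if 0 < a then f ((a - 1) ::ₘ S.erase a) else 0) := by
    intro a
    split_ifs <;> simp
  simp only [total, h, Multiset.sum_map_mul_left]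
  ring

theorem total_sub (f g : Multiset ℕ → ℝ) (S : Multiset ℕ) :
    total (fun U => f U - g U) S = total f S - total g S := by
  have := total_add f (fun U => (-1) * g U) S
  rw [total_const_mul] at this
  simp only [neg_mul, one_mul, ← sub_eq_add_neg] at this
  exact this

theorem total_mono {f g : Multiset ℕ → ℝ} (h : ∀ U, f U ≤ g U) (S : Multiset ℕ) :
    total f S ≤ total g S := by
  have h1 := h (0 ::ₘ S)
  have h2 := Multiset.sum_map_le_sum_map (s := S.powersetCard 2)
    (fun P => f (P.sum ::ₘ (S - P))) (fun P => g (P.sum ::ₘ (S - P))) fun P _ => h _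
  have h3 := Multiset.sum_map_le_sum_map (s := S)
    (fun a => f ((a + 1) ::ₘ S.erase a)) (fun a => g ((a + 1) ::ₘ S.erase a)) fun a _ => h _
  have h4 := Multiset.sum_map_le_sum_map (s := S)
    (fun a => if 0 < a then f ((a - 1) ::ₘ S.erase a) else 0)
    (fun a => if 0 < a then g ((a - 1) ::ₘ S.erase a) else 0) fun a _ => by
      split_ifs
      exacts [h _, le_rfl]
  unfold total
  linarith

/-- The number of moves from a table with loads `S`. -/
noncomputable def numMoves (S : Multiset ℕ) : ℝ := total (fun _ => 1) S

theorem total_const (c : ℝ) (S : Multiset ℕ) : total (fun _ => c) S = c * numMoves S := by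
  rw [numMoves, ← total_const_mul]
  simp

theorem numMoves_cons (a : ℕ) (R : Multiset ℕ) :
    numMoves (a ::ₘ R) = numMoves R + R.card + 1 + if 0 < a then 1 else 0 := by
  rw [numMoves, total_cons]
  simp [numMoves]

theorem numMoves_zero : numMoves 0 = 1 := total_zero _

theorem numMoves_eq (S : Multiset ℕ) :
    numMoves S = 1 + S.card * (S.card - 1) / 2 + 2 * S.card - S.count 0 := by
  induction S using Multiset.induction with
  | empty => simp [numMoves_zero]
  | cons a R ih =>
    rw [numMoves_cons, ih, Multiset.count_cons]
    rcases Nat.eq_zero_or_pos a with rfl | ha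
    · simp
      ring
    · simp [ha, ha.ne]
      ring

theorem one_le_numMoves (S : Multiset ℕ) : 1 ≤ numMoves S := by
  induction S using Multiset.induction with
  | empty => simp [numMoves_zero]
  | cons a R ih =>
    rw [numMoves_cons]
    have : (0 : ℝ) ≤ R.card := Nat.cast_nonneg _
    split_ifs <;> linarith

theorem numMoves_pos (S : Multiset ℕ) : 0 < numMoves S := one_pos.trans_le (one_le_numMoves S)

theorem abs_total_sub_le {f g : Multiset ℕ → ℝ} {c : ℝ} (h : ∀ U, |f U - g U| ≤ c)
    (S : Multiset ℕ) : |total f S - total g S| ≤ c * numMoves S := by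
  rw [← total_sub, abs_le, ← neg_mul, ← total_const, ← total_const]
  exact ⟨total_mono (fun U => (abs_le.1 (h U)).1) S, total_mono (fun U => (abs_le.1 (h U)).2) S⟩

theorem abs_sum_map_sub_le {f g : ℕ → ℝ} {c : ℝ} (R : Multiset ℕ)
    (h : ∀ r ∈ R, |f r - g r| ≤ c) :
    |(R.map f).sum - (R.map g).sum| ≤ c * R.card := by
  induction R using Multiset.induction with
  | empty => simp
  | cons a R ih =>
    simp only [Multiset.map_cons, Multiset.sum_cons, Multiset.card_cons, Nat.cast_add,
      Nat.cast_one]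
    have h1 := abs_le.1 (h a (Multiset.mem_cons_self a R))
    have h2 := abs_le.1 (ih fun r hr => h r (Multiset.mem_cons_of_mem hr))
    rw [abs_le]
    constructor <;> nlinarith

theorem total_sum (S : Multiset ℕ) :
    total (fun U => (U.sum : ℝ)) S = S.sum * numMoves S + S.count 0 := by
  induction S using Multiset.induction with
  | empty => simp [total_zero]
  | cons a R ih =>
    rw [total_cons, numMoves_cons, Multiset.count_cons]
    simp only [Multiset.sum_cons, Nat.cast_add]
    rw [total_add, ih, total_const]
    have h : (R.map fun r => ((a : ℝ) + r + ((R.erase r).sum : ℕ))) =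
        R.map fun _ => (a : ℝ) + (R.sum : ℕ) := by
      refine Multiset.map_congr rfl fun r hr => ?_
      have := Multiset.sum_erase hr
      rw [← this]
      push_cast
      ring
    rw [h]
    simp only [Multiset.map_const', Multiset.sum_replicate, nsmul_eq_mul, Nat.cast_one]
    rcases Nat.eq_zero_or_pos a with rfl | ha
    · simp
      ring
    · simp [ha, ha.ne, Nat.cast_sub (Nat.succ_le_of_lt ha)]
      ring

theorem total_card (S : Multiset ℕ) :
    total (fun U => (U.card : ℝ)) S =
      S.card * numMoves S + 1 - S.card * (S.card - 1) / 2 := by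
  induction S using Multiset.induction with
  | empty => simp [total_zero]
  | cons a R ih =>
    rw [total_cons, numMoves_cons]
    simp only [Multiset.card_cons, Nat.cast_add, Nat.cast_one]
    rw [total_add, ih, total_const]
    have h : (R.map fun r => (((R.erase r).card : ℝ) + 1)) = R.map fun _ => (R.card : ℝ) := by
      refine Multiset.map_congr rfl fun r hr => ?_
      exact_mod_cast Multiset.card_erase_add_one hr
    rw [h]
    simp only [Multiset.map_const', Multiset.sum_replicate, nsmul_eq_mul]
    split_ifs <;> ring

/-! ### Expected numbers of olives -/

/-- `meanAfter n S` is the expected number of olives `n` moves after the loads are `S`. -/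
noncomputable def meanAfter : ℕ → Multiset ℕ → ℝ
  | 0, S => S.sum
  | n + 1, S => total (meanAfter n) S / numMoves S

theorem numMoves_mul_meanAfter_succ (n : ℕ) (S : Multiset ℕ) :
    numMoves S * meanAfter (n + 1) S = total (meanAfter n) S := by
  rw [meanAfter, mul_div_cancel₀ _ (numMoves_pos S).ne']

theorem two_mul_count_zero_le_numMoves (S : Multiset ℕ) : 2 * (S.count 0 : ℝ) ≤ numMoves S := by
  rw [numMoves_eq]
  have h1 : (S.count 0 : ℝ) ≤ S.card := Nat.cast_le.2 (Multiset.count_le_card 0 S)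
  have h2 : (0 : ℝ) ≤ ((S.card : ℝ) - 1) * (S.card - 2) := by
    rcases Nat.lt_or_ge S.card 2 with h | h
    · interval_cases S.card <;> norm_num
    · have : (2 : ℝ) ≤ S.card := by exact_mod_cast h
      nlinarith
  nlinarith

/-- In expectation, each move adds between `0` and `1/2` olive, because at most half of the moves
are the ones that put an olive on an empty plate. -/
theorem meanAfter_succ_sub_mem (n : ℕ) (S : Multiset ℕ) :
    0 ≤ meanAfter (n + 1) S - meanAfter n S ∧ meanAfter (n + 1) S - meanAfter n S ≤ 1 / 2 := by
  induction n generalizing S with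
  | zero =>
    have h := numMoves_mul_meanAfter_succ 0 S
    have h0 := numMoves_pos S
    have : numMoves S * (meanAfter 1 S - meanAfter 0 S) = S.count 0 := by
      rw [mul_sub, h]
      have := total_sum S
      simp only [meanAfter] at this ⊢
      rw [this]
      ring
    have h2 := two_mul_count_zero_le_numMoves S
    have h3 : (0 : ℝ) ≤ S.count 0 := Nat.cast_nonneg _
    constructor
    · by_contra hneg
      nlinarith
    · by_contra hneg
      nlinarith
  | succ n ih =>
    have h0 := numMoves_pos S
    have e : meanAfter (n + 1 + 1) S - meanAfter (n + 1) S =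
        total (fun U => meanAfter (n + 1) U - meanAfter n U) S / numMoves S := by
      rw [total_sub, sub_div]
      rfl
    rw [e, le_div_iff₀ h0, div_le_iff₀ h0, ← total_const, ← total_const]
    exact ⟨total_mono (fun U => (ih U).1) S, total_mono (fun U => (ih U).2) S⟩

/-- One more olive changes the expected number of olives at any later time by at most `1`.
The moves from the two tables correspond to each other, except that an olive on an otherwise empty
plate can be removed; that move leads back to the other table. -/
theorem abs_meanAfter_add_olive_le (n a : ℕ) (R : Multiset ℕ) :
    |meanAfter n ((a + 1) ::ₘ R) - meanAfter n (a ::ₘ R)| ≤ 1 := by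
  induction n generalizing a R with
  | zero => simp [meanAfter]
  | succ n ih =>
    have hy := numMoves_mul_meanAfter_succ n ((a + 1) ::ₘ R)
    have hx := numMoves_mul_meanAfter_succ n (a ::ₘ R)
    rw [total_cons, numMoves_cons] at hx hy
    have h1 := abs_total_sub_le (f := fun U => meanAfter n ((a + 1) ::ₘ U))
      (g := fun U => meanAfter n (a ::ₘ U)) (fun U => ih a U) R
    have h2 := abs_sum_map_sub_le (f := fun r => meanAfter n ((a + 1 + r) ::ₘ R.erase r))
      (g := fun r => meanAfter n ((a + r) ::ₘ R.erase r)) (c := 1) R (fun r _ => by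
        have := ih (a + r) (R.erase r)
        rwa [add_right_comm] at this)
    have h3 := ih (a + 1) R
    have hN := numMoves_pos R
    have hc : (0 : ℝ) ≤ R.card := Nat.cast_nonneg _
    rw [abs_le] at h1 h2 h3 ⊢
    rcases Nat.eq_zero_or_pos a with rfl | ha
    · have h5 := meanAfter_succ_sub_mem n (0 ::ₘ R)
      simp only [zero_add, lt_self_iff_false, if_false, zero_lt_one, if_true, add_zero,
        Nat.sub_self] at *
      constructor <;> by_contra hneg <;> nlinarith
    · obtain ⟨b, rfl⟩ := Nat.exists_eq_add_of_lt ha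
      have h4 := ih b R
      rw [abs_le] at h4
      simp only [zero_add, Nat.succ_pos, if_true, Nat.add_sub_cancel] at *
      constructor <;> by_contra hneg <;> nlinarith

/-- One more empty plate changes the expected number of olives at any later time by at most `2`.
Combining the new plate with any of the others undoes the change. -/
theorem abs_meanAfter_add_plate_le (n : ℕ) (S : Multiset ℕ) :
    |meanAfter n (0 ::ₘ S) - meanAfter n S| ≤ 2 := by
  induction n generalizing S with
  | zero => simp [meanAfter]
  | succ n ih =>
    rcases S.empty_or_exists_mem with rfl | ⟨s, hs⟩
    · have h := numMoves_mul_meanAfter_succ n 0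
      rw [numMoves_zero, total_zero, one_mul] at h
      have h1 := meanAfter_succ_sub_mem n {0}
      rw [h, Multiset.cons_zero, abs_le]
      constructor <;> linarith
    have hcard : (1 : ℝ) ≤ S.card := by
      exact_mod_cast Multiset.card_pos_iff_exists_mem.2 ⟨s, hs⟩
    have hy := numMoves_mul_meanAfter_succ n (0 ::ₘ S)
    have hx := numMoves_mul_meanAfter_succ n S
    rw [total_cons, numMoves_cons] at hy
    have h1 := abs_total_sub_le (f := fun U => meanAfter n (0 ::ₘ U)) (g := meanAfter n) ih S
    have h2 : (S.map fun r => meanAfter n ((0 + r) ::ₘ S.erase r)) =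
        S.map fun _ => meanAfter n S := by
      refine Multiset.map_congr rfl fun r hr => ?_
      rw [zero_add, Multiset.cons_erase hr]
    rw [h2] at hy
    simp only [Multiset.map_const', Multiset.sum_replicate, nsmul_eq_mul, lt_self_iff_false,
      if_false, add_zero] at hy
    have h3 := abs_meanAfter_add_olive_le n 0 S
    have h4 := meanAfter_succ_sub_mem n S
    have h5 := ih S
    have hN := numMoves_pos S
    rw [abs_le] at h1 h3 h5 ⊢
    constructor <;> by_contra hneg <;> nlinarith

/-- Moving olives between two plates changes the expected number of olives at any later time by at
most `3/2`. The moves correspond to each other, up to the removal of an olive from a plate that is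
empty on the other side, and combining the two plates makes the tables equal. -/
theorem abs_meanAfter_transfer_le (n a b c d : ℕ) (h : a + b = c + d) (R : Multiset ℕ) :
    |meanAfter n (a ::ₘ b ::ₘ R) - meanAfter n (c ::ₘ d ::ₘ R)| ≤ 3 / 2 := by
  induction n generalizing a b c d R with
  | zero =>
    have : (a : ℝ) + b = c + d := by exact_mod_cast h
    simp only [meanAfter, Multiset.sum_cons, Nat.cast_add, ← add_assoc, this, sub_self, abs_zero]
    norm_num
  | succ n ih =>
    -- all the moves other than the removal of an olive from one of the two plates
    have hmain : ∀ a b c d : ℕ, a + b = c + d →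
        |total (meanAfter n) (a ::ₘ b ::ₘ R) - total (meanAfter n) (c ::ₘ d ::ₘ R) -
          (((if 0 < a then meanAfter n ((a - 1) ::ₘ b ::ₘ R) else 0) +
            if 0 < b then meanAfter n (a ::ₘ (b - 1) ::ₘ R) else 0) -
          ((if 0 < c then meanAfter n ((c - 1) ::ₘ d ::ₘ R) else 0) +
            if 0 < d then meanAfter n (c ::ₘ (d - 1) ::ₘ R) else 0))| ≤
        3 / 2 * (numMoves R + 2 * R.card + 2) := by
      intro a b c d h
      rw [total_cons_cons, total_cons_cons, h]
      have h1 := abs_total_sub_le (f := fun U => meanAfter n (a ::ₘ b ::ₘ U))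
        (g := fun U => meanAfter n (c ::ₘ d ::ₘ U)) (fun U => ih a b c d h U) R
      have h2 := abs_sum_map_sub_le (f := fun r => meanAfter n (a ::ₘ (b + r) ::ₘ R.erase r))
        (g := fun r => meanAfter n (c ::ₘ (d + r) ::ₘ R.erase r)) R
        (fun r _ => ih a (b + r) c (d + r) (by omega) (R.erase r))
      have h3 := abs_sum_map_sub_le (f := fun r => meanAfter n ((a + r) ::ₘ b ::ₘ R.erase r))
        (g := fun r => meanAfter n ((c + r) ::ₘ d ::ₘ R.erase r)) R
        (fun r _ => ih (a + r) b (c + r) d (by omega) (R.erase r))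
      have h4 := ih a (b + 1) c (d + 1) (by omega) R
      have h5 := ih (a + 1) b (c + 1) d (by omega) R
      rw [abs_le] at *
      constructor <;> linarith
    have hN := numMoves_pos R
    have hR : (0 : ℝ) ≤ R.card := Nat.cast_nonneg _
    -- no plate is empty
    have hpos : ∀ a b c d : ℕ, a + 1 + (b + 1) = c + 1 + (d + 1) →
        |meanAfter (n + 1) ((a + 1) ::ₘ (b + 1) ::ₘ R) -
          meanAfter (n + 1) ((c + 1) ::ₘ (d + 1) ::ₘ R)| ≤ 3 / 2 := by
      intro a b c d h
      have h1 := hmain _ _ _ _ h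
      have h2 := ih a (b + 1) c (d + 1) (by omega) R
      have h3 := ih (a + 1) b (c + 1) d (by omega) R
      simp only [← numMoves_mul_meanAfter_succ, numMoves_cons, Nat.succ_pos, if_true,
        Nat.add_sub_cancel, Multiset.card_cons, Nat.cast_add, Nat.cast_one] at h1
      have hM : 0 < numMoves R + (R.card + 1) + 1 + 1 + R.card + 1 + 1 := by linarith
      rw [abs_le] at *
      constructor
      · refine le_of_mul_le_mul_left ?_ hM
        linarith
      · refine le_of_mul_le_mul_left ?_ hM
        linarith
    -- one of the four plates is empty
    have hzero : ∀ c d : ℕ, |meanAfter (n + 1) (0 ::ₘ (c + 1 + (d + 1)) ::ₘ R) -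
        meanAfter (n + 1) ((c + 1) ::ₘ (d + 1) ::ₘ R)| ≤ 3 / 2 := by
      intro c d
      have h1 := hmain 0 (c + 1 + (d + 1)) (c + 1) (d + 1) (zero_add _)
      have h2 := ih 0 (c + 1 + d) (c + 1) d (zero_add _) R
      have h3 := abs_meanAfter_add_olive_le n c ((d + 1) ::ₘ R)
      have h4 := ih 0 (c + 1 + (d + 1)) (c + 1) (d + 1) (zero_add _) R
      have h5 := meanAfter_succ_sub_mem n (0 ::ₘ (c + 1 + (d + 1)) ::ₘ R)
      have hs : 0 < c + 1 + (d + 1) := Nat.succ_pos _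
      simp only [hs, ← numMoves_mul_meanAfter_succ, numMoves_cons, Nat.succ_pos, if_true,
        Nat.add_sub_cancel, Multiset.card_cons, Nat.cast_add, Nat.cast_one, lt_self_iff_false,
        if_false, Nat.add_succ_sub_one] at h1
      have hM : 0 < numMoves R + (R.card + 1) + 1 + 1 + R.card + 1 + 1 := by linarith
      rw [abs_le] at *
      constructor
      · refine le_of_mul_le_mul_left ?_ hM
        linarith
      · refine le_of_mul_le_mul_left ?_ hM
        linarith
    have hzero_left : ∀ s c d : ℕ, s = c + 1 + (d + 1) → |meanAfter (n + 1) (0 ::ₘ s ::ₘ R) -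
        meanAfter (n + 1) ((c + 1) ::ₘ (d + 1) ::ₘ R)| ≤ 3 / 2 := by
      rintro _ c d rfl
      exact hzero c d
    have hzero_right : ∀ s c d : ℕ, s = c + 1 + (d + 1) → |meanAfter (n + 1) (s ::ₘ 0 ::ₘ R) -
        meanAfter (n + 1) ((c + 1) ::ₘ (d + 1) ::ₘ R)| ≤ 3 / 2 := by
      rintro _ c d rfl
      rw [Multiset.cons_swap]
      exact hzero c d
    have heq : a ::ₘ b ::ₘ R = c ::ₘ d ::ₘ R →
        |meanAfter (n + 1) (a ::ₘ b ::ₘ R) - meanAfter (n + 1) (c ::ₘ d ::ₘ R)| ≤ 3 / 2 := by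
      intro e
      rw [e, sub_self, abs_zero]
      norm_num
    rcases Nat.eq_zero_or_pos a with ha | ha <;> rcases Nat.eq_zero_or_pos b with hb | hb <;>
      rcases Nat.eq_zero_or_pos c with hc | hc <;> rcases Nat.eq_zero_or_pos d with hd | hd
    all_goals first
      | (exfalso; omega)
      | (have e1 : a = c := by omega
         have e2 : b = d := by omega
         exact heq (by rw [e1, e2]))
      | (have e1 : a = d := by omega
         have e2 : b = c := by omega
         exact heq (by rw [e1, e2, Multiset.cons_swap]))
      | skip
    · obtain ⟨c, rfl⟩ := Nat.exists_eq_succ_of_ne_zero hc.ne'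
      obtain ⟨d, rfl⟩ := Nat.exists_eq_succ_of_ne_zero hd.ne'
      subst ha
      exact hzero_left _ _ _ (by omega)
    · obtain ⟨c, rfl⟩ := Nat.exists_eq_succ_of_ne_zero hc.ne'
      obtain ⟨d, rfl⟩ := Nat.exists_eq_succ_of_ne_zero hd.ne'
      subst hb
      exact hzero_right _ _ _ (by omega)
    · obtain ⟨a, rfl⟩ := Nat.exists_eq_succ_of_ne_zero ha.ne'
      obtain ⟨b, rfl⟩ := Nat.exists_eq_succ_of_ne_zero hb.ne'
      subst hc
      rw [abs_sub_comm]
      exact hzero_left _ _ _ (by omega)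
    · obtain ⟨a, rfl⟩ := Nat.exists_eq_succ_of_ne_zero ha.ne'
      obtain ⟨b, rfl⟩ := Nat.exists_eq_succ_of_ne_zero hb.ne'
      subst hd
      rw [abs_sub_comm]
      exact hzero_right _ _ _ (by omega)
    · obtain ⟨a, rfl⟩ := Nat.exists_eq_succ_of_ne_zero ha.ne'
      obtain ⟨b, rfl⟩ := Nat.exists_eq_succ_of_ne_zero hb.ne'
      obtain ⟨c, rfl⟩ := Nat.exists_eq_succ_of_ne_zero hc.ne'
      obtain ⟨d, rfl⟩ := Nat.exists_eq_succ_of_ne_zero hd.ne'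
      exact hpos _ _ _ _ h

/-- One move from the loads `S` to the loads `S'`, up to the order of the plates. -/
inductive IsMove : Multiset ℕ → Multiset ℕ → Prop
  | addPlate (S : Multiset ℕ) : IsMove S (0 ::ₘ S)
  | combine (a b : ℕ) (R : Multiset ℕ) : IsMove (a ::ₘ b ::ₘ R) ((a + b) ::ₘ R)
  | addOlive (a : ℕ) (R : Multiset ℕ) : IsMove (a ::ₘ R) ((a + 1) ::ₘ R)
  | removeOlive (a : ℕ) (R : Multiset ℕ) : IsMove ((a + 1) ::ₘ R) (a ::ₘ R)

/-- Combining two plates is a transfer of all olives to one of them and the removal of an empty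
plate. -/
theorem abs_meanAfter_move_le (n : ℕ) {S S' : Multiset ℕ} (h : IsMove S S') :
    |meanAfter n S' - meanAfter (n + 1) S| ≤ 4 := by
  have h0 := meanAfter_succ_sub_mem n S
  suffices |meanAfter n S' - meanAfter n S| ≤ 7 / 2 by
    rw [abs_le] at *
    constructor <;> linarith
  cases h with
  | addPlate => exact (abs_meanAfter_add_plate_le n S).trans (by norm_num)
  | combine a b R =>
    have h1 := abs_meanAfter_add_plate_le n ((a + b) ::ₘ R)
    have h2 := abs_meanAfter_transfer_le n a b 0 (a + b) (zero_add _).symm R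
    rw [abs_le] at *
    constructor <;> linarith
  | addOlive a R => exact (abs_meanAfter_add_olive_le n a R).trans (by norm_num)
  | removeOlive a R =>
    rw [abs_sub_comm]
    exact (abs_meanAfter_add_olive_le n a R).trans (by norm_num)

/-! ### From lists to multisets -/

theorem sum_moves (T : Table) (g : Move → ℝ) :
    ∑ m ∈ moves T, g m = g .addPlate +
      ∑ j ∈ Finset.range T.length, ∑ i ∈ Finset.range j, g (.combine i j) +
      ∑ i ∈ Finset.range T.length, g (.addOlive i) +
      ∑ i ∈ Finset.range T.length, if 0 < T.getD i 0 then g (.removeOlive i) else 0 := by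
  have hpair : ∑ p ∈ (Finset.range T.length ×ˢ Finset.range T.length).filter
      (fun p => p.1 < p.2), g (.combine p.1 p.2) =
      ∑ j ∈ Finset.range T.length, ∑ i ∈ Finset.range j, g (.combine i j) := by
    rw [Finset.sum_filter, Finset.sum_product_right]
    refine Finset.sum_congr rfl fun j hj => ?_
    rw [← Finset.sum_filter]
    refine Finset.sum_congr ?_ fun _ _ => rfl
    ext i
    have := Finset.mem_range.1 hj
    simp only [Finset.mem_filter, Finset.mem_range]
    omega
  rw [moves, Finset.sum_union, Finset.sum_union, Finset.sum_union, Finset.sum_singleton,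
    Finset.sum_image, Finset.sum_image, Finset.sum_image, hpair, Finset.sum_filter]
  · simp
  · simp
  · rintro ⟨a, b⟩ _ ⟨c, d⟩ _ h
    simpa using h
  all_goals
    rw [Finset.disjoint_left]
    intro m hm hm'
    simp only [Finset.mem_union, Finset.mem_singleton, Finset.mem_image] at hm hm'
    grind

theorem coe_eq_cons_eraseIdx (T : Table) {i : ℕ} (hi : i < T.length) :
    (T : Multiset ℕ) = T.getD i 0 ::ₘ (T.eraseIdx i : Multiset ℕ) := by
  rw [Multiset.cons_coe, Multiset.coe_eq_coe, List.getD_eq_getElem _ _ hi]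
  exact (List.getElem_cons_eraseIdx_perm hi).symm

theorem coe_set (T : Table) {i : ℕ} (hi : i < T.length) (v : ℕ) :
    (T.set i v : Multiset ℕ) = v ::ₘ (T : Multiset ℕ).erase (T.getD i 0) := by
  rw [coe_eq_cons_eraseIdx T hi, Multiset.erase_cons_head, Multiset.cons_coe, Multiset.coe_eq_coe]
  exact List.set_perm_cons_eraseIdx hi v

/-- Plates `i < j` of a table, and what combining them does to the loads. -/
theorem exists_coe_combine (T : Table) {i j : ℕ} (hij : i < j) (hj : j < T.length) :
    ∃ R : Multiset ℕ, (T : Multiset ℕ) = T.getD i 0 ::ₘ T.getD j 0 ::ₘ R ∧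
      (play T (.combine i j) : Multiset ℕ) = (T.getD i 0 + T.getD j 0) ::ₘ R := by
  have hi : i < T.length := hij.trans hj
  set v := T.getD i 0 + T.getD j 0 with hv
  have h1 := coe_eq_cons_eraseIdx (T.set i v) (i := j) (by simpa using hj)
  have e : (T.set i v).getD j 0 = T.getD j 0 := by
    simp [List.getD, List.getElem?_set_ne hij.ne]
  rw [e, coe_set T hi] at h1
  -- the load of plate `j` is still there when plate `i` is taken away
  have hmem : T.getD j 0 ∈ (T : Multiset ℕ).erase (T.getD i 0) := by
    rw [coe_eq_cons_eraseIdx T hi, Multiset.erase_cons_head, Multiset.mem_coe]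
    have hj' : j - 1 < (T.eraseIdx i).length := by
      rw [List.length_eraseIdx_of_lt hi]
      omega
    have e2 : (T.eraseIdx i)[j - 1] = T.getD j 0 := by
      rw [List.getD_eq_getElem _ _ hj, List.getElem_eraseIdx_of_ge _ (by omega)]
      congr 1
      omega
    rw [← e2]
    exact List.getElem_mem hj'
  refine ⟨((T : Multiset ℕ).erase (T.getD i 0)).erase (T.getD j 0), ?_, ?_⟩
  · rw [Multiset.cons_erase hmem, Multiset.cons_erase]
    rw [coe_eq_cons_eraseIdx T hi]
    exact Multiset.mem_cons_self _ _
  · have h2 := congrArg (fun S => Multiset.erase S (T.getD j 0)) h1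
    simp only [Multiset.erase_cons_head] at h2
    rw [← Multiset.cons_erase hmem, Multiset.cons_swap, Multiset.erase_cons_head] at h2
    rw [h2]
    rfl

theorem coe_combine (T : Table) {i j : ℕ} (hij : i < j) (hj : j < T.length) :
    (play T (.combine i j) : Multiset ℕ) =
      Multiset.sum {T.getD i 0, T.getD j 0} ::ₘ ((T : Multiset ℕ) - {T.getD i 0, T.getD j 0}) := by
  obtain ⟨R, h1, h2⟩ := exists_coe_combine T hij hj
  rw [h2, h1]
  simp [Multiset.sub_cons]

theorem sum_range_getD (T : Table) (φ : ℕ → ℝ) :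
    ∑ i ∈ Finset.range T.length, φ (T.getD i 0) = ((T : Multiset ℕ).map φ).sum := by
  induction T with
  | nil => simp
  | cons a T ih =>
    rw [List.length_cons, Finset.sum_range_succ']
    simp only [List.getD_cons_succ, List.getD_cons_zero, ih]
    simp [add_comm]

theorem sum_pairs_getD (T : Table) (g : Multiset ℕ → ℝ) :
    ∑ j ∈ Finset.range T.length, ∑ i ∈ Finset.range j, g {T.getD i 0, T.getD j 0} =
      (((T : Multiset ℕ).powersetCard 2).map g).sum := by
  induction T using List.reverseRecOn with
  | nil => simp [Multiset.powersetCard_zero_right]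
  | append_singleton T a ih =>
    have hcoe : ((T ++ [a] : List ℕ) : Multiset ℕ) = a ::ₘ (T : Multiset ℕ) := by
      rw [Multiset.cons_coe, Multiset.coe_eq_coe]
      exact List.perm_append_singleton a T
    have hlt : ∀ i < T.length, (T ++ [a]).getD i 0 = T.getD i 0 := fun i hi =>
      List.getD_append _ _ _ _ hi
    have hlast : (T ++ [a]).getD T.length 0 = a := by simp [List.getD]
    rw [hcoe, Multiset.powersetCard_cons, Multiset.map_add, Multiset.sum_add, ← ih,
      List.length_append, List.length_singleton, Finset.sum_range_succ, hlast,
      Multiset.powersetCard_one, Multiset.map_map, Multiset.map_map]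
    congr 1
    · refine Finset.sum_congr rfl fun j hj => Finset.sum_congr rfl fun i hi => ?_
      rw [Finset.mem_range] at hi hj
      rw [hlt j hj, hlt i (hi.trans hj)]
    · rw [← sum_range_getD]
      refine Finset.sum_congr rfl fun i hi => ?_
      rw [hlt i (Finset.mem_range.1 hi), Multiset.pair_comm]
      rfl

theorem sum_moves_coe (f : Multiset ℕ → ℝ) (T : Table) :
    ∑ m ∈ moves T, f (play T m : Table) = total f T := by
  rw [sum_moves, total]
  congr 1
  · congr 1
    · congr 1
      · congr 1
        rw [Multiset.cons_coe, Multiset.coe_eq_coe]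
        exact List.perm_append_singleton 0 T
      · rw [← sum_pairs_getD T fun P => f (P.sum ::ₘ ((T : Multiset ℕ) - P))]
        refine Finset.sum_congr rfl fun j hj => Finset.sum_congr rfl fun i hi => ?_
        rw [Finset.mem_range] at hi hj
        rw [coe_combine T hi hj]
    · rw [← sum_range_getD T fun a => f ((a + 1) ::ₘ (T : Multiset ℕ).erase a)]
      refine Finset.sum_congr rfl fun i hi => ?_
      rw [play, coe_set T (Finset.mem_range.1 hi)]
  · rw [← sum_range_getD T fun a => if 0 < a then f ((a - 1) ::ₘ (T : Multiset ℕ).erase a) else 0]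
    refine Finset.sum_congr rfl fun i hi => ?_
    rw [play, coe_set T (Finset.mem_range.1 hi)]

theorem card_moves (T : Table) : ((moves T).card : ℝ) = numMoves T := by
  rw [numMoves, ← sum_moves_coe]
  simp

theorem avg_coe (f : Multiset ℕ → ℝ) (T : Table) :
    avg (fun T' => f T') T = total f T / numMoves T := by
  rw [avg, sum_moves_coe, card_moves]

theorem isMove_play (T : Table) (m : Move) (hm : m ∈ moves T) :
    IsMove (T : Multiset ℕ) (play T m : Table) := by
  rw [mem_moves] at hm
  cases m with
  | addPlate =>
    have : ((T ++ [0] : List ℕ) : Multiset ℕ) = 0 ::ₘ (T : Multiset ℕ) := by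
      rw [Multiset.cons_coe, Multiset.coe_eq_coe]
      exact List.perm_append_singleton 0 T
    rw [play, this]
    exact .addPlate _
  | combine i j =>
    obtain ⟨R, h1, h2⟩ := exists_coe_combine T hm.1 hm.2
    rw [h2, h1]
    exact .combine _ _ _
  | addOlive i =>
    have hi : i < T.length := hm
    rw [play, coe_set T hi, coe_eq_cons_eraseIdx T hi, Multiset.erase_cons_head]
    exact .addOlive _ _
  | removeOlive i =>
    obtain ⟨hi, h0⟩ := hm
    obtain ⟨b, hb⟩ := Nat.exists_eq_succ_of_ne_zero h0.ne'
    rw [play, coe_set T hi, coe_eq_cons_eraseIdx T hi, Multiset.erase_cons_head, hb]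
    exact .removeOlive _ _

/-! ### Concentration -/

theorem meanOlives_eq (t : ℕ) : meanOlives t = meanAfter t 0 := by
  suffices ∀ n s, ∫ h, meanAfter n (h.current : Multiset ℕ) ∂(law s).toMeasure =
      meanAfter (n + s) 0 by
    have h := this 0 t
    rw [zero_add] at h
    rw [← h, meanOlives]
    simp [meanAfter, History.olives]
  intro n s
  induction s generalizing n with
  | zero => rw [integral_law_zero]; rfl
  | succ s ih =>
    rw [integral_law_succ, add_comm s 1, ← add_assoc, ← ih (n + 1)]
    simp only [avg_coe]
    rfl

theorem prob_abs_sub_meanOlives_le {u : ℝ} (hu : 0 ≤ u) (t : ℕ) :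
    prob t {h | u ≤ |(h.olives : ℝ) - meanOlives t|} ≤ 2 * Real.exp (-(u ^ 2 / (32 * t))) := by
  have hstep : ∀ s < t, ∃ n, t - s = n + 1 ∧ t - (s + 1) = n := fun s hs =>
    ⟨t - (s + 1), by omega, rfl⟩
  have hmart : ∀ s < t, ∀ T : Table,
      avg (fun T' => meanAfter (t - (s + 1)) T') T = meanAfter (t - s) T := by
    intro s hs T
    obtain ⟨n, h1, h2⟩ := hstep s hs
    rw [h1, h2, avg_coe]
    rfl
  have hinc : ∀ s < t, ∀ T : Table, ∀ m ∈ moves T,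
      |meanAfter (t - (s + 1)) (play T m : Table) - meanAfter (t - s) (T : Multiset ℕ)| ≤ 4 := by
    intro s hs T m hm
    obtain ⟨n, h1, h2⟩ := hstep s hs
    rw [h1, h2]
    exact abs_meanAfter_move_le n (isMove_play T m hm)
  have h1 := prob_add_le_le_exp (c := 4) (by norm_num) hu t
    (fun s T => meanAfter (t - s) (T : Multiset ℕ)) (fun s hs T => (hmart s hs T).le) hinc
  have h2 := prob_add_le_le_exp (c := 4) (by norm_num) hu t
    (fun s T => (-1) * meanAfter (t - s) (T : Multiset ℕ))
    (fun s hs T => by rw [avg_const_mul, hmart s hs T]) (fun s hs T m hm => by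
      rw [← mul_sub, abs_mul, abs_neg, abs_one, one_mul]
      exact hinc s hs T m hm)
  have hnum : (2 : ℝ) * 4 ^ 2 * t = 32 * t := by norm_num
  rw [hnum] at h1 h2
  refine ((prob_mono t (E := {h | u ≤ |(h.olives : ℝ) - meanOlives t|})
      (F := {h | meanAfter (t - 0) (([] : Table) : Multiset ℕ) + u ≤
      meanAfter (t - t) (h.current : Multiset ℕ)} ∪
      {h | (-1) * meanAfter (t - 0) (([] : Table) : Multiset ℕ) + u ≤
      (-1) * meanAfter (t - t) (h.current : Multiset ℕ)}) ?_).trans (prob_union_le t _ _)).trans ?_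
  rotate_left
  · linarith
  · intro h hh
    simp only [Set.mem_ofPred_eq, Set.mem_union, meanOlives_eq, Nat.sub_self, Nat.sub_zero,
      meanAfter, Multiset.sum_coe, Multiset.coe_nil] at hh ⊢
    rw [History.olives] at hh
    rcases le_abs.1 hh with h | h
    · left; linarith
    · right; linarith

/-! ### Linear growth -/

theorem abs_sum_move_le {S S' : Multiset ℕ} (h : IsMove S S') :
    |(S'.sum : ℝ) - S.sum| ≤ 1 := by
  cases h <;> simp [add_assoc]

theorem prob_olives_upper (t : ℕ) :
    prob t {h | 2 / 3 * (t : ℝ) ≤ h.olives} ≤ Real.exp (-(t / 162)) := by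
  rcases Nat.eq_zero_or_pos t with rfl | ht
  · simpa using prob_le_one 0 _
  have ht' : (0 : ℝ) < t := Nat.cast_pos.2 ht
  have h := prob_add_le_le_exp (c := 3 / 2) (u := t / 6) (by norm_num) (by positivity) t
    (fun s T => ((T : Multiset ℕ).sum : ℝ) + -((s : ℝ) / 2)) (fun s _ T => by
      rw [avg_add, avg_const, avg_coe (fun S => (S.sum : ℝ)), total_sum]
      have h0 := numMoves_pos (T : Multiset ℕ)
      have h1 := two_mul_count_zero_le_numMoves (T : Multiset ℕ)
      rw [add_div, mul_div_cancel_right₀ _ h0.ne']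
      have h2 : ((T : Multiset ℕ).count 0 : ℝ) / numMoves T ≤ 1 / 2 := by
        rw [div_le_iff₀ h0]
        linarith
      push_cast at h2 ⊢
      linarith) (fun s _ T m hm => by
      have := abs_le.1 (abs_sum_move_le (isMove_play T m hm))
      rw [Nat.cast_add_one, abs_le]
      constructor <;> linarith)
  refine (prob_mono t fun h hh => ?_).trans (h.trans (le_of_eq ?_))
  · simp only [Set.mem_ofPred_eq, History.olives, Multiset.sum_coe, List.sum_nil,
      Nat.cast_zero] at hh ⊢
    linarith
  · congr 1
    field_simp
    norm_num

/-- The indicator of the presence of an empty plate. -/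
noncomputable def hasEmpty (S : Multiset ℕ) : ℝ := if 0 ∈ S then 1 else 0

theorem hasEmpty_nonneg (S : Multiset ℕ) : 0 ≤ hasEmpty S := by
  unfold hasEmpty; split_ifs <;> norm_num

theorem hasEmpty_le_one (S : Multiset ℕ) : hasEmpty S ≤ 1 := by
  unfold hasEmpty; split_ifs <;> norm_num

theorem one_le_total_hasEmpty (S : Multiset ℕ) : 1 ≤ total hasEmpty S := by
  have h1 : 0 ≤ ((S.powersetCard 2).map fun P => hasEmpty (P.sum ::ₘ (S - P))).sum :=
    Multiset.sum_nonneg (by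
      intro x hx
      obtain ⟨P, -, rfl⟩ := Multiset.mem_map.1 hx
      exact hasEmpty_nonneg _)
  have h2 : 0 ≤ (S.map fun a => hasEmpty ((a + 1) ::ₘ S.erase a)).sum :=
    Multiset.sum_nonneg (by
      intro x hx
      obtain ⟨P, -, rfl⟩ := Multiset.mem_map.1 hx
      exact hasEmpty_nonneg _)
  have h3 : 0 ≤ (S.map fun a => if 0 < a then hasEmpty ((a - 1) ::ₘ S.erase a) else 0).sum :=
    Multiset.sum_nonneg (by
      intro x hx
      obtain ⟨P, -, rfl⟩ := Multiset.mem_map.1 hx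
      split_ifs
      exacts [hasEmpty_nonneg _, le_rfl])
  have h4 : hasEmpty (0 ::ₘ S) = 1 := by simp [hasEmpty]
  rw [total]
  linarith

theorem hasEmpty_cons_zero (S : Multiset ℕ) : hasEmpty (0 ::ₘ S) = 1 := by simp [hasEmpty]

/-- All moves except those that involve a given empty plate leave it empty. -/
theorem numMoves_le_total_hasEmpty (R : Multiset ℕ) :
    numMoves (0 ::ₘ R) ≤ total hasEmpty (0 ::ₘ R) + R.card + 1 := by
  rw [total_cons, numMoves_cons]
  simp only [hasEmpty_cons_zero, lt_self_iff_false, if_false]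
  have h2 : 0 ≤ (R.map fun r => hasEmpty ((0 + r) ::ₘ R.erase r)).sum :=
    Multiset.sum_nonneg (by
      intro x hx
      obtain ⟨P, -, rfl⟩ := Multiset.mem_map.1 hx
      exact hasEmpty_nonneg _)
  have := hasEmpty_nonneg ((0 + 1) ::ₘ R)
  rw [total_const]
  linarith

/-- With two empty plates, no move can destroy both. -/
theorem total_hasEmpty_eq_numMoves (R : Multiset ℕ) :
    total hasEmpty (0 ::ₘ 0 ::ₘ R) = numMoves (0 ::ₘ 0 ::ₘ R) := by
  have h : ((0 ::ₘ R).map fun r => hasEmpty ((0 + r) ::ₘ (0 ::ₘ R).erase r)) =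
      (0 ::ₘ R).map fun _ => 1 := by
    refine Multiset.map_congr rfl fun r hr => ?_
    rw [zero_add, Multiset.cons_erase hr, hasEmpty_cons_zero]
  rw [total_cons, numMoves_cons, h, Multiset.cons_swap]
  simp only [hasEmpty_cons_zero, lt_self_iff_false, if_false, total_const]
  simp [add_comm]

/-- The number of olives, corrected by a reward for an empty plate and a penalty for the number of
plates, so that it has a uniformly positive drift. -/
noncomputable def potential (S : Multiset ℕ) : ℝ := S.sum + 1 / 5 * hasEmpty S - 1 / 10 * S.card

theorem total_potential_ge (S : Multiset ℕ) :
    (potential S + 1 / 30) * numMoves S ≤ total potential S := by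
  have h1 : total potential S = S.sum * numMoves S + S.count 0 + 1 / 5 * total hasEmpty S -
      1 / 10 * (S.card * numMoves S + 1 - S.card * (S.card - 1) / 2) := by
    unfold potential
    rw [total_sub, total_add, total_sum, total_const_mul, total_const_mul, total_card]
  suffices 1 / 5 * hasEmpty S * numMoves S + 1 / 30 * numMoves S ≤
      S.count 0 + 1 / 5 * total hasEmpty S -
        1 / 10 * (1 - S.card * (S.card - 1) / 2) by
    rw [h1, potential]
    linarith
  by_cases hS : 0 ∈ S
  · obtain ⟨R, rfl⟩ := Multiset.exists_cons_of_mem hS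
    by_cases hR : 0 ∈ R
    · obtain ⟨Q, rfl⟩ := Multiset.exists_cons_of_mem hR
      rw [total_hasEmpty_eq_numMoves, hasEmpty_cons_zero, numMoves_eq]
      simp only [Multiset.count_cons_self, Multiset.card_cons]
      push_cast
      have : (0 : ℝ) ≤ Q.count 0 := Nat.cast_nonneg _
      have : (0 : ℝ) ≤ Q.card := Nat.cast_nonneg _
      nlinarith
    · have h2 := numMoves_le_total_hasEmpty R
      rw [hasEmpty_cons_zero]
      rw [numMoves_eq] at h2 ⊢
      simp only [Multiset.count_cons_self, Multiset.card_cons,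
        Multiset.count_eq_zero_of_notMem hR] at h2 ⊢
      push_cast at h2 ⊢
      nlinarith [sq_nonneg ((R.card : ℝ) - 7 / 2)]
  · have h2 := one_le_total_hasEmpty S
    have h3 : hasEmpty S = 0 := by simp [hasEmpty, hS]
    rw [h3, numMoves_eq, Multiset.count_eq_zero_of_notMem hS]
    -- no integer lies strictly between `1` and `2`
    have h4 : (0 : ℝ) ≤ ((S.card : ℝ) - 1) * (S.card - 2) := by
      rcases Nat.lt_or_ge S.card 2 with h | h
      · interval_cases S.card <;> norm_num
      · have : (2 : ℝ) ≤ S.card := by exact_mod_cast h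
        nlinarith
    push_cast
    nlinarith

theorem abs_potential_move_le {S S' : Multiset ℕ} (h : IsMove S S') :
    |potential S' - potential S| ≤ 13 / 10 := by
  have h1 := abs_le.1 (abs_sum_move_le h)
  have h2 : |(S'.card : ℝ) - S.card| ≤ 1 := by cases h <;> simp
  rw [abs_le] at h2 ⊢
  have := hasEmpty_nonneg S
  have := hasEmpty_nonneg S'
  have := hasEmpty_le_one S
  have := hasEmpty_le_one S'
  unfold potential
  constructor <;> linarith

theorem prob_olives_lower {t : ℕ} (ht : 30 ≤ t) :
    prob t {h | (h.olives : ℝ) ≤ 1 / 342 * t} ≤ Real.exp (-(t / 20000)) := by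
  have ht' : (30 : ℝ) ≤ t := by exact_mod_cast ht
  have h := prob_add_le_le_exp (c := 2) (u := t / 50) (by norm_num) (by positivity) t
    (fun s T => (-1) * potential (T : Multiset ℕ) + (s : ℝ) / 30) (fun s _ T => by
      rw [avg_add, avg_const, avg_const_mul, avg_coe]
      have h0 := numMoves_pos (T : Multiset ℕ)
      have h1 := total_potential_ge (T : Multiset ℕ)
      rw [← le_div_iff₀ h0] at h1
      push_cast
      linarith) (fun s _ T m hm => by
      have := abs_le.1 (abs_potential_move_le (isMove_play T m hm))
      rw [Nat.cast_add_one, abs_le]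
      constructor <;> linarith)
  refine (prob_mono t fun h hh => ?_).trans (h.trans (le_of_eq ?_))
  · have h1 := hasEmpty_le_one (h.current : Multiset ℕ)
    have h2 : (0 : ℝ) ≤ (h.current : Multiset ℕ).card := Nat.cast_nonneg _
    simp only [Set.mem_ofPred_eq, History.olives, Multiset.sum_coe, potential] at hh ⊢
    simp only [Multiset.coe_nil, Multiset.card_zero, hasEmpty, Multiset.notMem_zero, if_false,
      List.sum_nil, Nat.cast_zero] at h1 h2 ⊢
    linarith
  · congr 1
    field_simp
    norm_num

/-! ### The plates other than the first -/

/-- An exponential weight of the loads of all plates but the first. The factor for the number of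
plates compensates the olives that are put on empty plates when there are many of them. -/
noncomputable def weight (S : Multiset ℕ) : ℝ := (5 / 4) ^ S.card * (11 / 10) ^ S.sum

theorem weight_cons (a : ℕ) (S : Multiset ℕ) :
    weight (a ::ₘ S) = 5 / 4 * (11 / 10) ^ a * weight S := by
  simp only [weight, Multiset.card_cons, Multiset.sum_cons, pow_add, pow_one]
  ring

theorem pow_card_le_weight (S : Multiset ℕ) : (5 / 4 : ℝ) ^ S.card ≤ weight S :=
  le_mul_of_one_le_right (by positivity) (one_le_pow₀ (by norm_num))

theorem weight_pos (S : Multiset ℕ) : 0 < weight S := by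
  unfold weight
  positivity

theorem pow_le_weight {S : Multiset ℕ} {n : ℕ} (hn : n ∈ S) : (11 / 10 : ℝ) ^ n ≤ weight S :=
  (pow_le_pow_right₀ (by norm_num) (Multiset.le_sum_of_mem hn)).trans
    (le_mul_of_one_le_left (by positivity) (one_le_pow₀ (by norm_num)))

theorem total_weight_le (S : Multiset ℕ) :
    total weight S ≤
      weight S * (numMoves S + 1 / 4 - S.card * (S.card - 1) / 10 + S.card / 10) := by
  induction S using Multiset.induction with
  | empty => simp [total_zero, numMoves_zero, weight]; norm_num
  | cons a R ih =>
    have h1 : total (fun U => weight (a ::ₘ U)) R = 5 / 4 * (11 / 10) ^ a * total weight R := by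
      simp only [weight_cons, total_const_mul]
    have h2 : (R.map fun r => weight ((a + r) ::ₘ R.erase r)) =
        R.map fun _ => (11 / 10) ^ a * weight R := by
      refine Multiset.map_congr rfl fun r hr => ?_
      conv_rhs => rw [← Multiset.cons_erase hr]
      rw [weight_cons, weight_cons, pow_add]
      ring
    have h3 : (if 0 < a then weight ((a - 1) ::ₘ R) else 0) ≤
        weight (a ::ₘ R) * if 0 < a then 1 else 0 := by
      split_ifs with ha
      · rw [mul_one, weight_cons, weight_cons]
        have := weight_pos R
        gcongr
        · norm_num
        · omega
      · simp
    rw [total_cons, h1, h2, numMoves_cons]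
    simp only [Multiset.map_const', Multiset.sum_replicate, nsmul_eq_mul, Multiset.card_cons]
    have h4 := mul_le_mul_of_nonneg_left ih (show (0 : ℝ) ≤ 5 / 4 * (11 / 10) ^ a by positivity)
    rw [weight_cons a R] at h3 ⊢
    rw [weight_cons (a + 1) R, pow_succ]
    push_cast
    linarith

/-- The effect of combining the first plate with another one, summed over the other plates `S`.
Every such move removes the factor `5 / 4`, and together the moves remove the exponential of the
number of olives once, since `∑ (1 - x i) ≥ 1 - ∏ x i` for `x i ∈ [0, 1]`. -/
theorem sum_weight_erase_le (S : Multiset ℕ) :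
    (S.map fun r => weight (S.erase r)).sum ≤
      4 / 5 * ((S.card - 1) * weight S + (5 / 4) ^ S.card) := by
  induction S using Multiset.induction with
  | empty => simp [weight]
  | cons a R ih =>
    have h : (R.map fun r => weight ((a ::ₘ R).erase r)) =
        R.map fun r => 5 / 4 * (11 / 10) ^ a * weight (R.erase r) := by
      refine Multiset.map_congr rfl fun r hr => ?_
      rw [Multiset.erase_cons_tail_of_mem hr, weight_cons]
    rw [Multiset.map_cons, Multiset.sum_cons, Multiset.erase_cons_head, h,
      Multiset.sum_map_mul_left, weight_cons, Multiset.card_cons, pow_succ]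
    have h1 := mul_le_mul_of_nonneg_left ih (show (0 : ℝ) ≤ 5 / 4 * (11 / 10) ^ a by positivity)
    have h2 : (1 : ℝ) ≤ (11 / 10) ^ a := one_le_pow₀ (by norm_num)
    have h3 := mul_nonneg (sub_nonneg.2 h2) (sub_nonneg.2 (pow_card_le_weight R))
    push_cast
    linarith

/-- The moves from a table with first plate `x`, seen on the other plates `L` only. -/
theorem sum_moves_tail (f : Multiset ℕ → ℝ) (x : ℕ) (L : List ℕ) :
    ∑ m ∈ moves (x :: L), f ((play (x :: L) m).tail : List ℕ) =
      total f L + ((L : Multiset ℕ).map fun r => f ((L : Multiset ℕ).erase r)).sum + f L +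
        if 0 < x then f L else 0 := by
  rw [sum_moves, ← sum_moves_coe, sum_moves, List.length_cons, Finset.sum_range_succ',
    Finset.sum_range_succ', Finset.sum_range_succ']
  simp only [Finset.sum_range_succ', Finset.sum_add_distrib]
  have h : ∑ j ∈ Finset.range L.length, f ((play (x :: L) (.combine 0 (j + 1))).tail : List ℕ) =
      ((L : Multiset ℕ).map fun r => f ((L : Multiset ℕ).erase r)).sum := by
    rw [← sum_range_getD L fun r => f ((L : Multiset ℕ).erase r)]
    refine Finset.sum_congr rfl fun j hj => ?_
    have := coe_eq_cons_eraseIdx L (Finset.mem_range.1 hj)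
    conv_rhs => rw [this, Multiset.erase_cons_head]
    rfl
  rw [h]
  simp [play]
  ring

/-- Apart from a bounded error, the weight of the plates other than the first does not increase in
expectation. -/
theorem avg_weight_tail_le (T : Table) :
    avg (fun T' => weight (T'.tail : List ℕ)) T ≤ weight (T.tail : List ℕ) + 1 := by
  cases T with
  | nil =>
    have h : moves [] = {Move.addPlate} := by
      ext m
      rw [mem_moves]
      cases m <;> simp [Available]
    simp [avg, h, play, weight]
  | cons x L =>
    have hN := one_le_numMoves ((x :: L : List ℕ) : Multiset ℕ)
    rw [avg, sum_moves_tail, card_moves, div_le_iff₀ (by linarith), List.tail_cons]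
    rw [← Multiset.cons_coe, numMoves_cons] at hN ⊢
    generalize (L : Multiset ℕ) = S at *
    have h1 := total_weight_le S
    have h2 := sum_weight_erase_le S
    have h3 := pow_card_le_weight S
    have h4 : (0 : ℝ) ≤ S.card * (S.card - 1) := by
      rcases Nat.eq_zero_or_pos S.card with h | h
      · simp [h]
      · have : (1 : ℝ) ≤ S.card := by exact_mod_cast h
        nlinarith
    have h5 : (0 : ℝ) ≤ S.card := Nat.cast_nonneg _
    have h6 : (if 0 < x then weight S else 0) = weight S * if 0 < x then 1 else 0 := by
      split_ifs <;> simp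
    -- only few plates can make the expectation increase
    have h7 : (5 / 4 : ℝ) ^ S.card * (1 / 4 - S.card * (S.card - 1) / 10 - S.card / 10) ≤ 1 := by
      rcases Nat.lt_or_ge S.card 2 with h | h
      · interval_cases S.card <;> norm_num
      · have h8 : (2 : ℝ) ≤ S.card := by exact_mod_cast h
        have h9 : (1 / 4 : ℝ) - S.card * (S.card - 1) / 10 - S.card / 10 ≤ 0 := by nlinarith
        exact (mul_nonpos_of_nonneg_of_nonpos (by positivity) h9).trans zero_le_one
    have h8 := mul_nonneg (sub_nonneg.2 h3)
      (show (0 : ℝ) ≤ 11 / 20 + S.card * (S.card - 1) / 10 + S.card / 10 by positivity)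
    rw [h6]
    linarith

theorem integral_weight_tail_le (t : ℕ) :
    ∫ h, weight (h.current.tail : List ℕ) ∂(law t).toMeasure ≤ t + 1 := by
  have h := integral_le_of_avg_le t (fun s T => weight (T.tail : List ℕ) + -(s : ℝ))
    (fun s _ T => by
      rw [avg_add, avg_const, Nat.cast_add_one]
      have := avg_weight_tail_le T
      linarith)
  rw [integral_add (integrable_law _ _) (integrable_law _ _)] at h
  simp [weight] at h
  simp [weight]
  linarith

theorem integral_sum_weight_le (t : ℕ) :
    ∫ h, (h.tables.map fun T => weight (T.tail : List ℕ)).sum ∂(law t).toMeasure ≤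
      ((t : ℝ) + 1) ^ 2 := by
  induction t with
  | zero =>
    rw [integral_law_zero]
    simp [History.tables, weight]
  | succ t ih =>
    have h := integral_weight_tail_le (t + 1)
    rw [integral_law_succ] at h ⊢
    have e : ∀ h : History, avg (fun T => (((⟨T, h.tables⟩ : History).tables).map
        fun T => weight (T.tail : List ℕ)).sum) h.current =
        avg (fun T => weight (T.tail : List ℕ)) h.current +
          (h.tables.map fun T => weight (T.tail : List ℕ)).sum := by
      intro h
      have := avg_add (fun T => weight (T.tail : List ℕ))
        (fun _ => (h.tables.map fun T => weight (T.tail : List ℕ)).sum) h.current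
      rw [avg_const] at this
      exact this
    simp only [e]
    rw [integral_add (integrable_law _ _) (integrable_law _ _)]
    push_cast at h ⊢
    nlinarith

theorem prob_exists_large_le (t : ℕ) {v y : ℝ} (hv : 0 < v)
    (hy : ∀ n : ℕ, y < n → v ≤ (11 / 10 : ℝ) ^ n) :
    prob t {h | ∀ T ∈ h.tables, ∀ n ∈ T.tail, (n : ℝ) ≤ y}ᶜ ≤ ((t : ℝ) + 1) ^ 2 / v := by
  have hnn : ∀ l : List Table, ∀ z ∈ l.map fun T => weight (T.tail : List ℕ), 0 ≤ z := by
    intro l z hz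
    obtain ⟨T, -, rfl⟩ := List.mem_map.1 hz
    exact (weight_pos _).le
  have h := prob_le_integral_div t
    (g := fun h => (h.tables.map fun T => weight (T.tail : List ℕ)).sum)
    (fun h => List.sum_nonneg (hnn _)) hv
  refine (prob_mono t fun h hh => ?_).trans
    (h.trans (div_le_div_of_nonneg_right (integral_sum_weight_le t) hv.le))
  simp only [Set.mem_compl_iff, Set.mem_ofPred_eq, not_forall, not_le] at hh ⊢
  obtain ⟨T, hT, n, hn, hlt⟩ := hh
  exact (hy n hlt).trans ((pow_le_weight (Multiset.mem_coe.2 hn)).trans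
    (List.single_le_sum (hnn _) _ (List.mem_map_of_mem hT)))

end PlatesOlives

theorem theorem1 :
    -- (a) linear growth of the number of olives
    (∃ C c₁ c₂ : ℝ, 0 < C ∧ 1 / 342 ≤ c₁ ∧ c₁ ≤ c₂ ∧ c₂ ≤ 2 / 3 ∧
      ∀ᶠ t : ℕ in Filter.atTop,
        1 - Real.exp (-(C * t)) ≤
          PlatesOlives.prob t {h | c₁ * t ≤ (h.olives : ℝ) ∧ (h.olives : ℝ) ≤ c₂ * t}) ∧
    -- (b) concentration around the mean
    (∃ A K : ℝ, 0 < A ∧ ∀ (t : ℕ) (δ : ℝ), 0 ≤ δ → K ≤ δ ^ 2 * t →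
      PlatesOlives.prob t {h | δ * t ≤ |(h.olives : ℝ) - PlatesOlives.meanOlives t|} ≤
        Real.exp (-(A * δ ^ 2 * t))) ∧
    -- (c) all plates but the first carry logarithmically many olives, up to time t
    (∃ B : ℝ, 0 < B ∧
      Filter.Tendsto
        (fun t : ℕ => PlatesOlives.prob t
          {h | ∀ T ∈ h.tables, ∀ n ∈ T.tail, (n : ℝ) ≤ B * Real.log t})
        Filter.atTop (nhds 1)) := by
  have hexp : ∀ y : ℝ, 1 ≤ y → 2 * Real.exp (-(2 * y)) ≤ Real.exp (-y) := by
    intro y hy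
    have h1 := Real.add_one_le_exp y
    have h2 : Real.exp (-(2 * y)) * Real.exp y = Real.exp (-y) := by
      rw [← Real.exp_add]
      congr 1
      ring
    rw [← h2, mul_comm]
    exact mul_le_mul_of_nonneg_left (by linarith) (Real.exp_pos _).le
  refine ⟨⟨1 / 40000, 1 / 342, 2 / 3, by norm_num, le_rfl, by norm_num, le_rfl, ?_⟩,
    ⟨1 / 64, 64, by norm_num, ?_⟩, ?_⟩
  · filter_upwards [eventually_ge_atTop 40000] with t ht
    have ht' : (40000 : ℝ) ≤ t := by exact_mod_cast ht
    set E : Set PlatesOlives.History :=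
      {h | 1 / 342 * (t : ℝ) ≤ (h.olives : ℝ) ∧ (h.olives : ℝ) ≤ 2 / 3 * t} with hE
    have h1 : PlatesOlives.prob t Eᶜ ≤ PlatesOlives.prob t {h | 2 / 3 * (t : ℝ) ≤ h.olives} +
        PlatesOlives.prob t {h | (h.olives : ℝ) ≤ 1 / 342 * t} := by
      refine (PlatesOlives.prob_mono t fun h hh => ?_).trans
        (PlatesOlives.prob_union_le t _ _)
      simp only [hE, Set.mem_compl_iff, Set.mem_ofPred_eq, Set.mem_union, not_and_or,
        not_le] at hh ⊢
      exact hh.symm.imp le_of_lt le_of_lt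
    have h2 := PlatesOlives.prob_olives_upper t
    have h3 := PlatesOlives.prob_olives_lower (t := t) (by omega)
    have h4 : Real.exp (-((t : ℝ) / 162)) ≤ Real.exp (-((t : ℝ) / 20000)) := by
      rw [Real.exp_le_exp]
      linarith
    have h5 := hexp (1 / 40000 * t) (by linarith)
    rw [show 2 * (1 / 40000 * (t : ℝ)) = t / 20000 by ring] at h5
    rw [PlatesOlives.prob_compl] at h1
    linarith
  · intro t δ hδ hK
    have ht : (0 : ℝ) < t := by
      rcases Nat.eq_zero_or_pos t with rfl | ht
      · norm_num at hK
      · exact_mod_cast ht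
    have h := PlatesOlives.prob_abs_sub_meanOlives_le (u := δ * t) (by positivity) t
    have h5 := hexp (1 / 64 * δ ^ 2 * t) (by linarith)
    have e : (δ * t) ^ 2 / (32 * t) = 2 * (1 / 64 * δ ^ 2 * t) := by
      field_simp
      ring
    rw [e] at h
    exact h.trans h5
  · have hlog : 0 < Real.log (11 / 10) := Real.log_pos (by norm_num)
    -- `B` is chosen so that `(11 / 10) ^ (B * log t) = t ^ 3`
    refine ⟨3 / Real.log (11 / 10), by positivity, ?_⟩
    have hlim : Tendsto (fun t : ℕ => 1 - 4 / (t : ℝ)) atTop (𝓝 1) := by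
      simpa using tendsto_const_nhds.sub (tendsto_const_div_atTop_nhds_zero_nat (4 : ℝ))
    refine tendsto_of_tendsto_of_tendsto_of_le_of_le' hlim tendsto_const_nhds ?_
      (Eventually.of_forall fun t => PlatesOlives.prob_le_one t _)
    filter_upwards [eventually_ge_atTop 1] with t ht
    have ht' : (1 : ℝ) ≤ t := by exact_mod_cast ht
    have ht0 : (0 : ℝ) < t := by linarith
    have h := PlatesOlives.prob_exists_large_le t (v := (t : ℝ) ^ 3)
      (y := 3 / Real.log (11 / 10) * Real.log t) (by positivity) (fun n hn => by
        rw [div_mul_eq_mul_div, div_lt_iff₀ hlog] at hn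
        rw [← Real.log_le_log_iff (by positivity) (by positivity), Real.log_pow, Real.log_pow]
        exact_mod_cast hn.le)
    rw [PlatesOlives.prob_compl] at h
    have h2 : ((t : ℝ) + 1) ^ 2 / (t : ℝ) ^ 3 ≤ 4 / t := by
      rw [div_le_div_iff₀ (by positivity) ht0]
      have : 0 ≤ (t : ℝ) * ((3 * t + 1) * (t - 1)) :=
        mul_nonneg ht0.le (mul_nonneg (by linarith) (by linarith))
      nlinarith
    linarith
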